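/- Let $A$ be a complex Banach algebra (not necessarily unital), let $A^{**}$ be its second dual with the first Arens product, and let $A^{****}=(A^{**})^{**}$ with the first Arens product built from $A^{**}$. A Banach algebra is Arens regular if the two Arens products on its second dual coincide. A dual Banach algebra is a Banach algebra $B$ together with a closed sub-bimodule $B_*\subseteq B^*$ (the predual) such that the canonical map $B\to (B_*)^*$ is an isometric isomorphism. It is Connes amenable (with respect to $B_*$) if every weak*-weak* continuous derivation $D:B\to E^*$ is inner, i.e. of the form $D(b)=b\cdot\varphi-\varphi\cdot b$ with $\varphi\in E^*$, whenever $E$ is a Banach $B$-bimodule whose dual module $E^*$ is normal, i.e. for every $\varphi\in E^*$ the maps $b\mapsto b\cdot\varphi$ and $b\mapsto\varphi\cdot b$ are weak*-weak* continuous. A Banach algebra $B$ is amenable if for every Banach $B$-bimodule $E$ every bounded derivation $B\to E^*$ is inner. **Theorem 1.1.** Suppose that $A^{**}$ is Arens regular and that $A^{****}$ is Connes amenable with respect to its canonical predual $A^{***}$. Then $A^{**}$ is a Connes amenable dual Banach algebra with respect to its canonical predual $A^{*}$. If, moreover, the canonical image of $A^{**}$ in $A^{****}$ is a two-sided ideal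 of $A^{****}$, then $A^{**}$ is amenable and reflexive as a Banach space. -/

import Mathlib

universe u

/-! ### Modules and derivations -/

/-- A Banach bimodule structure on `E` over the Banach algebra `B`: a bounded left action
`left a x = a · x` and a bounded right action `right a x = x · a`, which are compatible. -/
structure BanachBimodule (B E : Type u) [NonUnitalNormedRing B] [NormedSpace ℂ B]
    [NormedAddCommGroup E] [NormedSpace ℂ E] where
  left : B →L[ℂ] E →L[ℂ] E
  right : B →L[ℂ] E →L[ℂ] E
  left_mul : ∀ (a b : B) (x : E), left (a * b) x = left a (left b x)
  right_mul : ∀ (a b : B) (x : E), right (a * b) x = right b (right a x)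
  left_right : ∀ (a b : B) (x : E), left a (right b x) = right b (left a x)

namespace BanachBimodule

variable {B E : Type u} [NonUnitalNormedRing B] [NormedSpace ℂ B]
  [NormedAddCommGroup E] [NormedSpace ℂ E]

/-- The left action on the dual module: `(a · φ)(x) = φ (x · a)`. -/
noncomputable def dualLeft (M : BanachBimodule B E) (a : B) (φ : StrongDual ℂ E) : StrongDual ℂ E :=
  φ.comp (M.right a)

/-- The right action on the dual module: `(φ · a)(x) = φ (a · x)`. -/
noncomputable def dualRight (M : BanachBimodule B E) (a : B) (φ : StrongDual ℂ E) : StrongDual ℂ E :=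
  φ.comp (M.left a)

/-- `D` is a derivation into the dual module `E*`: `D (a b) = D a · b + a · D b`. -/
def IsDerivation (M : BanachBimodule B E) (D : B →ₗ[ℂ] StrongDual ℂ E) : Prop :=
  ∀ a b : B, D (a * b) = M.dualRight b (D a) + M.dualLeft a (D b)

/-- `D` is inner: `D a = a · φ - φ · a` for some `φ` in the dual module `E*`. -/
def IsInner (M : BanachBimodule B E) (D : B →ₗ[ℂ] StrongDual ℂ E) : Prop :=
  ∃ φ : StrongDual ℂ E, ∀ a : B, D a = M.dualLeft a φ - M.dualRight a φ

end BanachBimodule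

/-- Amenability: every bounded derivation into every dual Banach bimodule is inner. -/
def IsAmenable (B : Type u) [NonUnitalNormedRing B] [NormedSpace ℂ B] : Prop :=
  ∀ (E : Type u) [NormedAddCommGroup E] [NormedSpace ℂ E] [CompleteSpace E]
    (M : BanachBimodule B E) (D : B →ₗ[ℂ] StrongDual ℂ E),
    Continuous D → M.IsDerivation D → M.IsInner D

/-! ### The dual of an algebra, preduals, Connes amenability -/

section Dual

variable (A : Type u) [NonUnitalNormedRing A] [NormedSpace ℂ A]
  [IsScalarTower ℂ A A] [SMulCommClass ℂ A A]

/-- The right action of `A` on `A*`: `dualMulRight A f a b = (f · a)(b) = f (a b)`. -/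
noncomputable def dualMulRight : StrongDual ℂ A →L[ℂ] A →L[ℂ] StrongDual ℂ A :=
  ((ContinuousLinearMap.compL ℂ A (A →L[ℂ] A) (A →L[ℂ] ℂ)).flip
    (ContinuousLinearMap.mul ℂ A)).comp (ContinuousLinearMap.compL ℂ A A ℂ)

/-- The left action of `A` on `A*`: `dualMulLeft A f a b = (a · f)(b) = f (b a)`. -/
noncomputable def dualMulLeft : StrongDual ℂ A →L[ℂ] A →L[ℂ] StrongDual ℂ A :=
  ((ContinuousLinearMap.compL ℂ A (A →L[ℂ] A) (A →L[ℂ] ℂ)).flip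
    (ContinuousLinearMap.mul ℂ A).flip).comp (ContinuousLinearMap.compL ℂ A A ℂ)

@[simp] theorem dualMulRight_apply (f : StrongDual ℂ A) (a b : A) :
    dualMulRight A f a b = f (a * b) := rfl

@[simp] theorem dualMulLeft_apply (f : StrongDual ℂ A) (a b : A) :
    dualMulLeft A f a b = f (b * a) := rfl

end Dual

section Predual

variable {B : Type u} [NonUnitalNormedRing B] [NormedSpace ℂ B]
  [IsScalarTower ℂ B B] [SMulCommClass ℂ B B]

/-- The canonical map `B → P*`, `b ↦ (f ↦ f b)`, for a subspace `P` of `B*`. -/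
noncomputable def toPredualDual (P : Submodule ℂ (StrongDual ℂ B)) (b : B) : StrongDual ℂ P :=
  (NormedSpace.inclusionInDoubleDual ℂ B b).comp P.subtypeL

/-- `B` is a dual Banach algebra with predual `P`: `P` is a closed subbimodule of `B*`, and the
canonical map `B → P*`, `b ↦ (f ↦ f b)`, is isometric (the norm of the functional `f ↦ f b`
on `P` is `‖b‖`) and onto. -/
structure IsPredual (P : Submodule ℂ (StrongDual ℂ B)) : Prop where
  isClosed : IsClosed (P : Set (StrongDual ℂ B))
  mulRight_mem : ∀ f ∈ P, ∀ a : B, dualMulRight B f a ∈ P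
  mulLeft_mem : ∀ f ∈ P, ∀ a : B, dualMulLeft B f a ∈ P
  isometric : ∀ b : B, IsLUB {r : ℝ | ∃ f ∈ P, ‖f‖ ≤ 1 ∧ r = ‖f b‖} ‖b‖
  surjective : Function.Surjective (toPredualDual P)

/-- The weak* topology on `B` given by `P`: the coarsest topology for which every functional
in `P` is continuous. -/
noncomputable abbrev weakStarTopology (P : Submodule ℂ (StrongDual ℂ B)) : TopologicalSpace B :=
  TopologicalSpace.induced (fun (b : B) (f : P) => (f : StrongDual ℂ B) b) inferInstance

/-- A map from `B`, with the weak* topology given by `P`, to `E*`, with its weak* topology,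
is continuous. -/
def IsWeakStarContinuous (P : Submodule ℂ (StrongDual ℂ B)) {E : Type u}
    [NormedAddCommGroup E] [NormedSpace ℂ E] (T : B → StrongDual ℂ E) : Prop :=
  @Continuous B (WeakDual ℂ E) (weakStarTopology P) inferInstance
    fun b => StrongDual.toWeakDual (T b)

/-- The dual module `E*` is normal: for each `φ` in `E*` the maps `a ↦ a · φ` and `a ↦ φ · a`
are weak*-weak* continuous. -/
def BanachBimodule.IsNormal (P : Submodule ℂ (StrongDual ℂ B)) {E : Type u}
    [NormedAddCommGroup E] [NormedSpace ℂ E] (M : BanachBimodule B E) : Prop :=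
  ∀ φ : StrongDual ℂ E, IsWeakStarContinuous P (fun a => M.dualLeft a φ) ∧
    IsWeakStarContinuous P (fun a => M.dualRight a φ)

/-- `B` is a Connes amenable dual Banach algebra (with respect to the predual `P`): every
weak*-weak* continuous derivation into every normal dual Banach bimodule is inner. -/
structure IsConnesAmenable (P : Submodule ℂ (StrongDual ℂ B)) : Prop where
  isPredual : IsPredual P
  isInner : ∀ (E : Type u) [NormedAddCommGroup E] [NormedSpace ℂ E] [CompleteSpace E]
    (M : BanachBimodule B E) (D : B →ₗ[ℂ] StrongDual ℂ E),
    M.IsNormal P → IsWeakStarContinuous P D → M.IsDerivation D → M.IsInner D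

end Predual

/-! ### The second dual with the Arens products -/

/-- The second dual `A**` of `A`; it carries the first Arens product. -/
def Bidual (A : Type u) [NonUnitalNormedRing A] [NormedSpace ℂ A] : Type u :=
  StrongDual ℂ (StrongDual ℂ A)

namespace Bidual

section Basic

variable {A : Type u} [NonUnitalNormedRing A] [NormedSpace ℂ A]

variable [IsScalarTower ℂ A A] [SMulCommClass ℂ A A]

/-- `(Ψ · f)(a) = Ψ (f · a)`, as a bounded operator in `f`. -/
noncomputable def act (Ψ : StrongDual ℂ (StrongDual ℂ A)) :
    StrongDual ℂ A →L[ℂ] StrongDual ℂ A :=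
  (ContinuousLinearMap.compL ℂ A (StrongDual ℂ A) ℂ Ψ).comp (dualMulRight A)

/-- `(f · Φ)(a) = Φ (a · f)`, as a bounded operator in `f`. -/
noncomputable def coact (Φ : StrongDual ℂ (StrongDual ℂ A)) :
    StrongDual ℂ A →L[ℂ] StrongDual ℂ A :=
  (ContinuousLinearMap.compL ℂ A (StrongDual ℂ A) ℂ Φ).comp (dualMulLeft A)

@[simp] theorem act_apply (Ψ : StrongDual ℂ (StrongDual ℂ A)) (f : StrongDual ℂ A) (a : A) :
    act Ψ f a = Ψ (dualMulRight A f a) := rfl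

@[simp] theorem coact_apply (Φ : StrongDual ℂ (StrongDual ℂ A)) (f : StrongDual ℂ A) (a : A) :
    coact Φ f a = Φ (dualMulLeft A f a) := rfl

/-- The first Arens product: `(Φ □ Ψ)(f) = Φ (Ψ · f)`. -/
noncomputable def firstArens (Φ Ψ : StrongDual ℂ (StrongDual ℂ A)) :
    StrongDual ℂ (StrongDual ℂ A) :=
  Φ.comp (act Ψ)

/-- The second Arens product: `(Φ ◇ Ψ)(f) = Ψ (f · Φ)`. -/
noncomputable def secondArens (Φ Ψ : StrongDual ℂ (StrongDual ℂ A)) :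
    StrongDual ℂ (StrongDual ℂ A) :=
  Ψ.comp (coact Φ)

theorem norm_dualMulRight_le (f : StrongDual ℂ A) (a : A) :
    ‖dualMulRight A f a‖ ≤ ‖f‖ * ‖a‖ :=
  ContinuousLinearMap.opNorm_le_bound _ (by positivity) fun b => by
    calc ‖f (a * b)‖ ≤ ‖f‖ * ‖a * b‖ := f.le_opNorm _
      _ ≤ ‖f‖ * (‖a‖ * ‖b‖) := by gcongr; exact norm_mul_le a b
      _ = ‖f‖ * ‖a‖ * ‖b‖ := by ring

theorem norm_firstArens_le (Φ Ψ : StrongDual ℂ (StrongDual ℂ A)) :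
    ‖firstArens Φ Ψ‖ ≤ ‖Φ‖ * ‖Ψ‖ := by
  refine (Φ.opNorm_comp_le _).trans ?_
  gcongr
  refine ContinuousLinearMap.opNorm_le_bound _ (by positivity) fun f => ?_
  refine ContinuousLinearMap.opNorm_le_bound _ (by positivity) fun a => ?_
  calc ‖Ψ (dualMulRight A f a)‖ ≤ ‖Ψ‖ * ‖dualMulRight A f a‖ := Ψ.le_opNorm _
    _ ≤ ‖Ψ‖ * (‖f‖ * ‖a‖) := by gcongr; exact norm_dualMulRight_le f a
    _ = ‖Ψ‖ * ‖f‖ * ‖a‖ := by ring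

theorem act_add (Φ Ψ : StrongDual ℂ (StrongDual ℂ A)) : act (Φ + Ψ) = act Φ + act Ψ := rfl

theorem act_smul (c : ℂ) (Ψ : StrongDual ℂ (StrongDual ℂ A)) : act (c • Ψ) = c • act Ψ := rfl

theorem firstArens_assoc (Φ Ψ Θ : StrongDual ℂ (StrongDual ℂ A)) :
    firstArens (firstArens Φ Ψ) Θ = firstArens Φ (firstArens Ψ Θ) := by
  refine ContinuousLinearMap.ext fun f => congrArg Φ (ContinuousLinearMap.ext fun a => ?_)
  refine congrArg Ψ (ContinuousLinearMap.ext fun b => congrArg Θ ?_)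
  exact ContinuousLinearMap.ext fun c => congrArg f (mul_assoc a b c)

/-- `A**` is a Banach algebra under the first Arens product. -/
noncomputable instance : NonUnitalNormedRing (Bidual A) where
  __ := (inferInstance : NormedAddCommGroup (StrongDual ℂ (StrongDual ℂ A)))
  mul Φ Ψ := firstArens Φ Ψ
  left_distrib Φ Ψ Θ := ContinuousLinearMap.ext fun f =>
    ContinuousLinearMap.map_add (M₁ := StrongDual ℂ A) Φ (act Ψ f) (act Θ f)
  right_distrib _ _ _ := rfl
  zero_mul _ := rfl
  mul_zero Φ := ContinuousLinearMap.ext fun _ =>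
    ContinuousLinearMap.map_zero (M₁ := StrongDual ℂ A) Φ
  mul_assoc Φ Ψ Θ := firstArens_assoc Φ Ψ Θ
  norm_mul_le Φ Ψ := norm_firstArens_le Φ Ψ

noncomputable instance : NormedSpace ℂ (Bidual A) where
  __ := (inferInstance : NormedSpace ℂ (StrongDual ℂ (StrongDual ℂ A)))

instance : IsScalarTower ℂ (Bidual A) (Bidual A) where
  smul_assoc _ _ _ := rfl

instance : SMulCommClass ℂ (Bidual A) (Bidual A) where
  smul_comm c Φ Ψ := ContinuousLinearMap.ext fun f =>
    (ContinuousLinearMap.map_smul (M₁ := StrongDual ℂ A) Φ c (act Ψ f)).symm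

instance : CompleteSpace (Bidual A) :=
  inferInstanceAs (CompleteSpace (StrongDual ℂ (StrongDual ℂ A)))

end Basic

variable (A : Type u) [NonUnitalNormedRing A] [NormedSpace ℂ A]
  [IsScalarTower ℂ A A] [SMulCommClass ℂ A A]

/-- The canonical embedding `A → A**`. -/
noncomputable def incl : A →L[ℂ] Bidual A := NormedSpace.inclusionInDoubleDual ℂ A

/-- The canonical embedding `A* → (A**)*`, which sends `f` to `Φ ↦ Φ f`. -/
noncomputable def evalAt : StrongDual ℂ A →L[ℂ] StrongDual ℂ (Bidual A) :=
  NormedSpace.inclusionInDoubleDual ℂ (StrongDual ℂ A)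

/-- The canonical predual `A*` of `A**`, as a subspace of `(A**)*`. -/
noncomputable def predual : Submodule ℂ (StrongDual ℂ (Bidual A)) :=
  LinearMap.range (evalAt A).toLinearMap

end Bidual

section Properties

variable (A : Type u) [NonUnitalNormedRing A] [NormedSpace ℂ A]
  [IsScalarTower ℂ A A] [SMulCommClass ℂ A A]

/-- `A` is Arens regular: the two Arens products on `A**` coincide. -/
def IsArensRegular : Prop :=
  ∀ Φ Ψ : StrongDual ℂ (StrongDual ℂ A), Bidual.firstArens Φ Ψ = Bidual.secondArens Φ Ψ

/-- `A` (that is, its canonical image) is a two-sided ideal of `A**`. -/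
def IsIdealOfBidual : Prop :=
  ∀ (a : A) (Φ : Bidual A), Φ * Bidual.incl A a ∈ Set.range (Bidual.incl A) ∧
    Bidual.incl A a * Φ ∈ Set.range (Bidual.incl A)

/-- `A` is reflexive: the canonical embedding `A → A**` is onto. -/
def IsReflexiveSpace : Prop :=
  Function.Surjective (Bidual.incl A)

end Properties

/-! ### Weak* continuity and the passage to amenability -/

section WeakStar

variable {B : Type u} [NonUnitalNormedRing B] [NormedSpace ℂ B]

/-! The restriction map `proj : A**** → A**`, adjoint to `A* → A***`, is weak*-weak* continuous and
splits the canonical embedding. When `A` is Arens regular, which follows from regularity of `A**`,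
it is also multiplicative (`proj_mul`). Normal modules and derivations of `A**` therefore pull back
to `A****`, and an implementing functional there also implements the original derivation. Connes
amenability then forces a right identity `e` in `A**` (`exists_right_identity`). Its image is a
right identity for all of `A****`, so if `A**` is an ideal, each `Φ = Φ * e` lies in `A**`, which is
thus reflexive. Reflexivity makes `A*` the whole dual of `A**`, so every bounded derivation is weak*
continuous and every dual module is normal: Connes amenability becomes amenability. -/

theorem continuous_weakStarTopology_eval {P : Submodule ℂ (StrongDual ℂ B)} {f : StrongDual ℂ B}
    (hf : f ∈ P) : @Continuous B ℂ (weakStarTopology P) inferInstance f := by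
  let _ := weakStarTopology P
  let ev : B → P → ℂ := fun b g => g.1 b
  have hev : Continuous ev := continuous_induced_dom
  exact (continuous_pi_iff.1 hev) ⟨f, hf⟩

/-- A map into a dual space is weak*-weak* continuous if its coordinates belong to the predual. -/
theorem IsWeakStarContinuous.of_forall_mem {P : Submodule ℂ (StrongDual ℂ B)} {E : Type u}
    [NormedAddCommGroup E] [NormedSpace ℂ E] {T : B → StrongDual ℂ E}
    (h : ∀ x : E, ∃ f ∈ P, ∀ b, T b x = f b) : IsWeakStarContinuous P T := by
  let _ := weakStarTopology P
  refine WeakDual.continuous_of_continuous_eval fun x => ?_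
  obtain ⟨f, hf, hfx⟩ := h x
  exact (continuous_weakStarTopology_eval hf).congr fun b => (hfx b).symm

theorem IsWeakStarContinuous.of_predual_eq_top {P : Submodule ℂ (StrongDual ℂ B)} (hP : P = ⊤)
    {E : Type u} [NormedAddCommGroup E] [NormedSpace ℂ E] (T : B →L[ℂ] StrongDual ℂ E) :
    IsWeakStarContinuous P T :=
  .of_forall_mem fun x => ⟨T.flip x, hP ▸ Submodule.mem_top, fun _ => rfl⟩

variable [IsScalarTower ℂ B B] [SMulCommClass ℂ B B]

/-- A Connes amenable algebra all of whose functionals are weak* continuous is amenable. -/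
theorem IsConnesAmenable.isAmenable_of_eq_top {P : Submodule ℂ (StrongDual ℂ B)}
    (h : IsConnesAmenable P) (hP : P = ⊤) : IsAmenable B := by
  intro E _ _ _ M D hD hder
  refine h.isInner E M D (fun φ => ⟨?_, ?_⟩) ?_ hder
  · exact .of_predual_eq_top hP ((ContinuousLinearMap.compL ℂ E E ℂ φ).comp M.right)
  · exact .of_predual_eq_top hP ((ContinuousLinearMap.compL ℂ E E ℂ φ).comp M.left)
  · exact .of_predual_eq_top hP ⟨D, hD⟩

end WeakStar

/-! ### Restriction of scalars and adjoints of bilinear maps -/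

namespace BanachBimodule

variable {B C E : Type u} [NonUnitalNormedRing B] [NormedSpace ℂ B]
  [NonUnitalNormedRing C] [NormedSpace ℂ C] [NormedAddCommGroup E] [NormedSpace ℂ E]

/-- Restriction of scalars of a bimodule along a bounded homomorphism. -/
noncomputable def comap (M : BanachBimodule B E) (π : C →L[ℂ] B)
    (hπ : ∀ x y, π (x * y) = π x * π y) : BanachBimodule C E where
  left := M.left.comp π
  right := M.right.comp π
  left_mul a b x := by simp [hπ, M.left_mul]
  right_mul a b x := by simp [hπ, M.right_mul]
  left_right a b x := by simp [M.left_right]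

end BanachBimodule

/-- Composition of a bounded bilinear map with functionals on its codomain. -/
noncomputable def ContinuousLinearMap.dualComp {X Y Z : Type*} [NormedAddCommGroup X]
    [NormedSpace ℂ X] [NormedAddCommGroup Y] [NormedSpace ℂ Y] [NormedAddCommGroup Z]
    [NormedSpace ℂ Z] (T : X →L[ℂ] Y →L[ℂ] Z) :
    StrongDual ℂ Z →L[ℂ] X →L[ℂ] StrongDual ℂ Y :=
  ((compL ℂ X (Y →L[ℂ] Z) (Y →L[ℂ] ℂ)).flip T).comp (compL ℂ Y Z ℂ)

/-! ### Arens regularity and descent from the fourth dual to the second -/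

namespace Bidual

variable {A : Type u} [NonUnitalNormedRing A] [NormedSpace ℂ A]
  [IsScalarTower ℂ A A] [SMulCommClass ℂ A A]

/-- An element of `A**` as a functional on `A*`. -/
def toStrongDual (Φ : Bidual A) : StrongDual ℂ (StrongDual ℂ A) := Φ

variable (A) in
/-- `coact` as a bounded operator into the bounded operators on `A*`. -/
noncomputable def coactL : Bidual A →L[ℂ] StrongDual ℂ A →L[ℂ] StrongDual ℂ A :=
  ContinuousLinearMap.dualComp (dualMulLeft A)

variable (A) in
/-- The adjoint `A*** → A*` of the canonical embedding. -/
noncomputable def inclAdjoint : StrongDual ℂ (Bidual A) →L[ℂ] StrongDual ℂ A :=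
  (ContinuousLinearMap.compL ℂ A (Bidual A) ℂ).flip (incl A)

variable (A) in
/-- The restriction `A**** → A**` to the canonical predual. -/
noncomputable def proj : Bidual (Bidual A) →L[ℂ] Bidual A :=
  (ContinuousLinearMap.compL ℂ (StrongDual ℂ A) (StrongDual ℂ (Bidual A)) ℂ).flip (evalAt A)

theorem evalAt_mem_predual (f : StrongDual ℂ A) : evalAt A f ∈ predual A := ⟨f, rfl⟩

theorem mul_apply_eq_of_isArensRegular (h : IsArensRegular A) (Φ Ψ : Bidual A)
    (f : StrongDual ℂ A) :
    (Φ * Ψ).toStrongDual f = Ψ.toStrongDual (coact Φ f) :=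
  DFunLike.congr_fun (h Φ Ψ) f

/-- Arens regularity passes from `A**` to `A`. -/
theorem isArensRegular_of_bidual (h : IsArensRegular (Bidual A)) : IsArensRegular A := by
  intro Φ Ψ
  ext f
  -- Precomposing with `inclAdjoint` is the second adjoint of `A → A**`; at `evalAt A f` both Arens
  -- products of the lifts unfold to those of `Φ` and `Ψ` at `f`.
  exact DFunLike.congr_fun (h (Φ.comp (inclAdjoint A)) (Ψ.comp (inclAdjoint A))) (evalAt A f)

theorem norm_evalAt (f : StrongDual ℂ A) : ‖evalAt A f‖ = ‖f‖ :=
  (NormedSpace.inclusionInDoubleDualLi ℂ (E := StrongDual ℂ A)).norm_map f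

variable (A) in
/-- The identification of `A*` with the canonical predual. -/
noncomputable def toPredual : StrongDual ℂ A →L[ℂ] predual A :=
  (evalAt A).codRestrict (predual A) evalAt_mem_predual

/-- Regularity is needed only for stability under the right action: it rewrites `Ψ ↦ (Φ * Ψ) f` as
evaluation at `coact Φ f`. The left action needs only the definition of the first product. -/
theorem isPredual (h : IsArensRegular A) : IsPredual (predual A) where
  isClosed := by
    have : Isometry (evalAt A) := AddMonoidHomClass.isometry_of_norm _ norm_evalAt
    exact this.isClosedEmbedding.isClosed_range
  mulRight_mem := by
    rintro _ ⟨f, rfl⟩ Φ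
    exact ⟨coact Φ f, ContinuousLinearMap.ext fun Ψ =>
      (mul_apply_eq_of_isArensRegular h Φ Ψ f).symm⟩
  mulLeft_mem := by
    rintro _ ⟨f, rfl⟩ Φ
    exact ⟨act Φ f, rfl⟩
  isometric := by
    intro Φ
    constructor
    · rintro _ ⟨F, -, hF, rfl⟩
      exact (F.le_opNorm Φ).trans (mul_le_of_le_one_left (norm_nonneg _) hF)
    · intro r hr
      have key : ∀ f : StrongDual ℂ A, ‖f‖ ≤ 1 →
          ‖Φ.toStrongDual f‖ ≤ r := fun f hf =>
        hr ⟨evalAt A f, evalAt_mem_predual f, (norm_evalAt f).trans_le hf, rfl⟩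
      have hr0 : 0 ≤ r := (norm_nonneg _).trans (key 0 (by simp))
      exact ContinuousLinearMap.opNorm_le_of_unit_norm hr0 fun f hf => key f hf.le
  surjective := by
    intro G
    refine ⟨G.comp (toPredual A), ContinuousLinearMap.ext ?_⟩
    rintro ⟨_, f, rfl⟩
    rfl

/-- The key to multiplicativity of `proj`: by regularity the functionals to which `Y` is applied
stay in the canonical predual, where `Y` is determined by `proj A Y`. -/
theorem act_evalAt (h : IsArensRegular A) (Y : Bidual (Bidual A)) (f : StrongDual ℂ A) :
    act Y (evalAt A f) = evalAt A (act (proj A Y) f) := by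
  refine ContinuousLinearMap.ext fun Φ => ?_
  have h₁ : dualMulRight (Bidual A) (evalAt A f) Φ = evalAt A (coact Φ f) :=
    ContinuousLinearMap.ext fun Ψ => mul_apply_eq_of_isArensRegular h Φ Ψ f
  exact (congrArg Y.toStrongDual h₁).trans (mul_apply_eq_of_isArensRegular h Φ (proj A Y) f).symm

theorem proj_mul (h : IsArensRegular A) (X Y : Bidual (Bidual A)) :
    proj A (X * Y) = proj A X * proj A Y :=
  ContinuousLinearMap.ext fun f =>
    congrArg X.toStrongDual (act_evalAt h Y f)

variable (A) in
theorem continuous_proj_weakStar :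
    @Continuous _ _ (weakStarTopology (predual (Bidual A))) (weakStarTopology (predual A))
      (proj A) := by
  let _ := weakStarTopology (predual (Bidual A))
  refine continuous_induced_rng.2 (continuous_pi ?_)
  rintro ⟨_, f, rfl⟩
  exact continuous_weakStarTopology_eval (evalAt_mem_predual (A := Bidual A) (evalAt A f))

theorem _root_.IsWeakStarContinuous.comp_proj {E : Type u} [NormedAddCommGroup E]
    [NormedSpace ℂ E] {T : Bidual A → StrongDual ℂ E}
    (hT : IsWeakStarContinuous (predual A) T) :
    IsWeakStarContinuous (predual (Bidual A)) fun X => T (proj A X) :=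
  @Continuous.comp _ _ _ (weakStarTopology (predual (Bidual A))) (weakStarTopology (predual A)) _
    _ _ hT (continuous_proj_weakStar A)

/-- Connes amenability passes from `A****` to `A**`. -/
theorem isConnesAmenable_predual (h : IsArensRegular A)
    (hc : IsConnesAmenable (predual (Bidual A))) : IsConnesAmenable (predual A) where
  isPredual := isPredual h
  isInner := by
    intro E _ _ _ M D hM hD hder
    obtain ⟨φ, hφ⟩ := hc.isInner E (M.comap (proj A) (proj_mul h)) (D.comp (proj A).toLinearMap)
      (fun φ => ⟨(hM φ).1.comp_proj, (hM φ).2.comp_proj⟩) hD.comp_proj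
      (fun X Y => (congrArg D (proj_mul h X Y)).trans (hder _ _))
    -- `proj` is a left inverse of `incl`, so evaluating on the image of `a` recovers the original
    -- identity.
    exact ⟨φ, fun a => hφ (incl (Bidual A) a)⟩

/-! ### Right identity, reflexivity and amenability -/

/-- `A*` as an `A**`-bimodule whose dual is `A**` with left multiplication and zero right
action. -/
noncomputable def leftDualBimodule (h : IsArensRegular A) :
    BanachBimodule (Bidual A) (StrongDual ℂ A) where
  left := 0
  right := coactL A
  left_mul _ _ _ := rfl
  right_mul a b x := by
    refine ContinuousLinearMap.ext fun c =>
      (mul_apply_eq_of_isArensRegular h a b (dualMulLeft A x c)).trans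
        (congrArg b.toStrongDual (ContinuousLinearMap.ext fun d => congrArg a.toStrongDual ?_))
    exact ContinuousLinearMap.ext fun e => congrArg x (mul_assoc e d c)
  left_right a b x := (map_zero (coactL A b)).symm

/-- With zero right action on `A**`, the derivation rule is left linearity, so the identity map is a
derivation; innerness says `a = a * e`. -/
theorem exists_right_identity (h : IsArensRegular A) (hc : IsConnesAmenable (predual A)) :
    ∃ e : Bidual A, ∀ a, a * e = a := by
  have hL : ∀ a φ : Bidual A, a * φ = (leftDualBimodule h).dualLeft a φ := h
  have hR : ∀ a φ : Bidual A, 0 = (leftDualBimodule h).dualRight a φ := fun a φ =>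
    ContinuousLinearMap.ext fun _ => (map_zero φ.toStrongDual).symm
  obtain ⟨(e : Bidual A), he⟩ := hc.isInner (StrongDual ℂ A) (leftDualBimodule h)
    (LinearMap.id : Bidual A →ₗ[ℂ] Bidual A)
    (fun φ => ⟨.of_forall_mem fun x => ⟨_, evalAt_mem_predual (act φ x), fun b =>
        congrArg (fun Φ : Bidual A => Φ.toStrongDual x) (hL b φ).symm⟩,
      .of_forall_mem fun x => ⟨0, zero_mem _, fun b =>
        congrArg (fun Φ : Bidual A => Φ.toStrongDual x) (hR b φ).symm⟩⟩)
    (.of_forall_mem fun x => ⟨_, evalAt_mem_predual x, fun _ => rfl⟩)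
    (fun a b => (zero_add (a * b)).symm.trans
      (congrArg₂ (fun x y : Bidual A => x + y) (hR b a) (hL a b)))
  exact ⟨e, fun a => ((he a).trans ((congrArg₂ (fun x y : Bidual A => x - y) (hL a e)
    (hR a e)).symm.trans (sub_zero (a * e)))).symm⟩

theorem mul_incl_eq_self {e : A} (he : ∀ a, a * e = a) (Φ : Bidual A) : Φ * incl A e = Φ :=
  ContinuousLinearMap.ext fun f =>
    congrArg Φ.toStrongDual (ContinuousLinearMap.ext fun a => congrArg f (he a))

/-- An algebra with a right identity which is an ideal of its bidual is reflexive. -/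
theorem isReflexiveSpace_of_isIdealOfBidual (hA : IsIdealOfBidual A) {e : A}
    (he : ∀ a, a * e = a) : IsReflexiveSpace A := fun Φ => by
  obtain ⟨a, ha⟩ := (hA e Φ).1
  exact ⟨a, ha.trans (mul_incl_eq_self he Φ)⟩

/-- If `A**` is reflexive, its canonical predual is the whole dual of `A**`. -/
theorem predual_eq_top (h : IsReflexiveSpace (Bidual A)) : predual A = ⊤ := by
  refine Submodule.eq_top_iff'.2 fun F => ⟨inclAdjoint A F, ContinuousLinearMap.ext fun b => ?_⟩
  -- By reflexivity the functional `G ↦ b (inclAdjoint A G)` is evaluation at some `c`; testing on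
  -- the canonical predual gives `c = b`, and testing on `F` gives the claim.
  obtain ⟨c, hc⟩ := h (b.toStrongDual.comp (inclAdjoint A))
  have hcb : c = b := ContinuousLinearMap.ext fun f => congrArg (fun Φ : Bidual (Bidual A) => Φ.toStrongDual (evalAt A f)) hc
  subst hcb
  exact (congrArg (fun Φ : Bidual (Bidual A) => Φ.toStrongDual F) hc).symm

end Bidual

theorem theorem1p1 {A : Type u} [NonUnitalNormedRing A] [NormedSpace ℂ A]
    [IsScalarTower ℂ A A] [SMulCommClass ℂ A A] [CompleteSpace A]
    (hreg : IsArensRegular (Bidual A))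
    (hconnes : IsConnesAmenable (Bidual.predual (Bidual A))) :
    IsConnesAmenable (Bidual.predual A) ∧
      (IsIdealOfBidual (Bidual A) →
        IsAmenable (Bidual A) ∧ IsReflexiveSpace (Bidual A)) := by
  have hA := Bidual.isArensRegular_of_bidual hreg
  have hc := Bidual.isConnesAmenable_predual hA hconnes
  refine ⟨hc, fun hideal => ?_⟩
  obtain ⟨e, he⟩ := Bidual.exists_right_identity hA hc
  have hrefl := Bidual.isReflexiveSpace_of_isIdealOfBidual hideal he
  exact ⟨hc.isAmenable_of_eq_top (Bidual.predual_eq_top hrefl), hrefl⟩
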